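/- **Definitions.** For $\mathbf d=(d_1,d_2)\in\mathbb Z^2$ let $\deg(\mathbf d)=d_1+d_2$, and order $\mathbb Z^2$ componentwise. A function $g\colon\mathbb Z^2\to\mathbb Z$ is *initially zero* (resp. *eventually zero*) if $g(\mathbf d)=0$ for all $\mathbf d$ of sufficiently small (resp. large) degree. A *Riemann function with offset* $C\in\mathbb Z$ is an initially zero $f\colon\mathbb Z^2\to\mathbb Z$ with $f(\mathbf d)=\deg(\mathbf d)+C$ for all $\mathbf d$ of sufficiently large degree. Its *weight* is the unique initially zero $W\colon\mathbb Z^2\to\mathbb Z$ with $f(\mathbf d)=\sum_{\mathbf d'\le\mathbf d}W(\mathbf d')$ for all $\mathbf d$, and for $\mathbf K\in\mathbb Z^2$ its *$\mathbf K$-dual* is $f^\wedge_{\mathbf K}(\mathbf d)=f(\mathbf K-\mathbf d)-\deg(\mathbf K-\mathbf d)-C$. A *perfect matching* is an initially and eventually zero $W\colon\mathbb Z^2\to\mathbb Z$ such that for some bijection $\pi\colon\mathbb Z\to\mathbb Z$ we have $W(i,j)=1$ if $j=\pi(i)$ and $W(i,j)=0$ otherwise. Let $k$ be a field. A *$k$-diagram*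 $\mathcal F$ consists of $k$-vector spaces $\mathcal F(B_1),\mathcal F(B_2),\mathcal F(B_3),\mathcal F(A_1),\mathcal F(A_2)$ and linear maps $\rho_{ij}\colon\mathcal F(B_i)\to\mathcal F(A_j)$ for $(i,j)\in\{(1,1),(2,2),(3,1),(3,2)\}$. Isomorphisms are families of linear isomorphisms of the five spaces that commute with the $\rho_{ij}$; direct sums are taken space by space. $H^0(\mathcal F)$ and $H^1(\mathcal F)$ are the kernel and the cokernel of $$\textstyle\bigoplus_{i=1}^{3}\mathcal F(B_i)\to\mathcal F(A_1)\oplus\mathcal F(A_2),\qquad (b_1,b_2,b_3)\mapsto(\rho_{11}b_1-\rho_{31}b_3,\ \rho_{22}b_2-\rho_{32}b_3),$$ $b^i(\mathcal F)=\dim_k H^i(\mathcal F)$, and $\mathcal F$ is *Fredholm* if $b^0(\mathcal F)$ and $b^1(\mathcal F)$ are finite. A *virtual Fredholm $k$-diagram* is a pair $\mathcal F_1\ominus\mathcal F_2$ of Fredholm $k$-diagrams; $\mathcal F_1\ominus\mathcal F_2\sim\mathcal F_1'\ominus\mathcal F_2'$ means $\mathcal F_1\oplus\mathcal F_2'\oplus\mathcal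 F_0\simeq\mathcal F_1'\oplus\mathcal F_2\oplus\mathcal F_0$ for some Fredholm $\mathcal F_0$. This is an equivalence relation, and $b^i(\mathcal F_1\ominus\mathcal F_2)=b^i(\mathcal F_1)-b^i(\mathcal F_2)\in\mathbb Z$ ($i=0,1$) and $\chi=b^0-b^1$ depend only on the equivalence class. For a perfect matching $W$ and $\mathbf d\in\mathbb Z^2$, $\mathcal M_{W,\mathbf d}$ is the $k$-diagram with $B_i=k^{\oplus\mathbb Z_{\le d_i}}$, $A_i=k^{\oplus\mathbb Z}$ and $\rho_{ii}$ the inclusion for $i=1,2$, with $B_3=k^{\oplus\{\mathbf a\,:\,W(\mathbf a)=1\}}$, and with $\rho_{3j}$ taking the basis vector $e_{(a_1,a_2)}$ to $e_{a_j}$ for $j=1,2$. It is Fredholm. **Proposition.** Let $k$ be a field, $f\colon\mathbb Z^2\to\mathbb Z$ a Riemann function with offset $C$ and weight $W$, and $\mathbf d\in\mathbb Z^2$. For any way of writing $$W=(W_1+\cdots+W_s)-(\tilde W_1+\cdots+\tilde W_{s-1})\qquad(s\ge 1)\tag{$*$}$$ with all $W_i$ and $\tilde W_i$ perfect matchings,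 let $[\mathcal M_{W,\mathbf d}]$ be the equivalence class of the virtual Fredholm $k$-diagram $$(\mathcal M_{W_1,\mathbf d}\oplus\cdots\oplus\mathcal M_{W_s,\mathbf d})\ominus(\mathcal M_{\tilde W_1,\mathbf d}\oplus\cdots\oplus\mathcal M_{\tilde W_{s-1},\mathbf d}).$$ Then $[\mathcal M_{W,\mathbf d}]$ does not depend on the way of writing $W$ in $(*)$ (including the choice of $s$), and for any way of writing $W$ as in $(*)$: 1. $b^0([\mathcal M_{W,\mathbf d}])=f(\mathbf d)$; 2. $b^1([\mathcal M_{W,\mathbf d}])=f^\wedge_{\mathbf K}(\mathbf K-\mathbf d)$ for every $\mathbf K\in\mathbb Z^2$; 3. $\chi([\mathcal M_{W,\mathbf d}])=\deg(\mathbf d)+C$. -/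

import Mathlib

open scoped DirectSum

universe u

/-! ### Riemann functions on `ℤ²`, weights, perfect matchings -/

/-- The degree of `d ∈ ℤ²`. The order on `ℤ × ℤ` is the componentwise one. -/
def deg (d : ℤ × ℤ) : ℤ := d.1 + d.2

/-- `f` vanishes in all sufficiently small degrees. -/
def InitiallyZero (f : ℤ × ℤ → ℤ) : Prop := ∃ a : ℤ, ∀ d, deg d ≤ a → f d = 0

/-- `f` vanishes in all sufficiently large degrees. -/
def EventuallyZero (f : ℤ × ℤ → ℤ) : Prop := ∃ b : ℤ, ∀ d, b ≤ deg d → f d = 0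

/-- `f` is a Riemann function with offset `C`. -/
def IsRiemannFunction (f : ℤ × ℤ → ℤ) (C : ℤ) : Prop :=
  InitiallyZero f ∧ ∃ b : ℤ, ∀ d, b ≤ deg d → f d = deg d + C

/-- The `K`-dual of a Riemann function `f` with offset `C`. -/
def dualFunction (f : ℤ × ℤ → ℤ) (C : ℤ) (K : ℤ × ℤ) (d : ℤ × ℤ) : ℤ :=
  f (K - d) - deg (K - d) - C

/-- `W` is the weight of `f`: it is initially zero and `f d = ∑_{d' ≤ d} W d'` for all `d`
(a finite sum, since `W` is initially zero). -/
def IsWeight (f W : ℤ × ℤ → ℤ) : Prop :=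
  InitiallyZero W ∧ ∀ d, f d = ∑ᶠ d' ∈ Set.Iic d, W d'

/-- A perfect matching: an initially and eventually zero indicator function of the graph of
a permutation of `ℤ`. -/
def IsPerfectMatching (W : ℤ × ℤ → ℤ) : Prop :=
  InitiallyZero W ∧ EventuallyZero W ∧
    ∃ π : Equiv.Perm ℤ, ∀ i j, W (i, j) = if j = π i then 1 else 0

/-- A way of writing `W = (W_1 + ⋯ + W_s) - (W̃_1 + ⋯ + W̃_{s-1})` with all `W_i`, `W̃_i` perfect
matchings; here `s = t + 1`. -/
structure MatchingDecomposition (W : ℤ × ℤ → ℤ) where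
  t : ℕ
  pos : Fin (t + 1) → ℤ × ℤ → ℤ
  neg : Fin t → ℤ × ℤ → ℤ
  pos_matching : ∀ i, IsPerfectMatching (pos i)
  neg_matching : ∀ i, IsPerfectMatching (neg i)
  eq_sub : W = ∑ i, pos i - ∑ i, neg i

/-! ### `k`-diagrams -/

/-- A `k`-diagram: five vector spaces and four restriction maps. -/
structure KDiagram (k : Type u) [Field k] where
  B1 : Type u
  B2 : Type u
  B3 : Type u
  A1 : Type u
  A2 : Type u
  [grpB1 : AddCommGroup B1]
  [grpB2 : AddCommGroup B2]
  [grpB3 : AddCommGroup B3]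
  [grpA1 : AddCommGroup A1]
  [grpA2 : AddCommGroup A2]
  [modB1 : Module k B1]
  [modB2 : Module k B2]
  [modB3 : Module k B3]
  [modA1 : Module k A1]
  [modA2 : Module k A2]
  r11 : B1 →ₗ[k] A1
  r22 : B2 →ₗ[k] A2
  r31 : B3 →ₗ[k] A1
  r32 : B3 →ₗ[k] A2

attribute [instance] KDiagram.grpB1 KDiagram.grpB2 KDiagram.grpB3 KDiagram.grpA1 KDiagram.grpA2
attribute [instance] KDiagram.modB1 KDiagram.modB2 KDiagram.modB3 KDiagram.modA1 KDiagram.modA2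

namespace KDiagram

variable {k : Type u} [Field k]

/-- The differential `(b₁, b₂, b₃) ↦ (ρ₁₁ b₁ - ρ₃₁ b₃, ρ₂₂ b₂ - ρ₃₂ b₃)`. -/
def differential (F : KDiagram k) : (F.B1 × F.B2 × F.B3) →ₗ[k] (F.A1 × F.A2) :=
  LinearMap.prod
    (F.r11 ∘ₗ LinearMap.fst k _ _ - F.r31 ∘ₗ LinearMap.snd k _ _ ∘ₗ LinearMap.snd k _ _)
    (F.r22 ∘ₗ LinearMap.fst k _ _ ∘ₗ LinearMap.snd k _ _
      - F.r32 ∘ₗ LinearMap.snd k _ _ ∘ₗ LinearMap.snd k _ _)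

theorem differential_apply (F : KDiagram k) (b : F.B1 × F.B2 × F.B3) :
    F.differential b = (F.r11 b.1 - F.r31 b.2.2, F.r22 b.2.1 - F.r32 b.2.2) := rfl

/-- The zeroth cohomology group. -/
abbrev H0 (F : KDiagram k) : Type u := LinearMap.ker F.differential

/-- The first cohomology group. -/
abbrev H1 (F : KDiagram k) : Type u := (F.A1 × F.A2) ⧸ LinearMap.range F.differential

/-- Both Betti numbers are finite. -/
def IsFredholm (F : KDiagram k) : Prop := Module.Finite k F.H0 ∧ Module.Finite k F.H1

/-- The zeroth Betti number (meaningful for Fredholm diagrams). -/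
noncomputable def b0 (F : KDiagram k) : ℕ := Module.finrank k F.H0

/-- The first Betti number (meaningful for Fredholm diagrams). -/
noncomputable def b1 (F : KDiagram k) : ℕ := Module.finrank k F.H1

/-- An isomorphism of `k`-diagrams: linear isomorphisms of all values that commute with the
restriction maps. -/
structure Iso (F G : KDiagram k) where
  eB1 : F.B1 ≃ₗ[k] G.B1
  eB2 : F.B2 ≃ₗ[k] G.B2
  eB3 : F.B3 ≃ₗ[k] G.B3
  eA1 : F.A1 ≃ₗ[k] G.A1
  eA2 : F.A2 ≃ₗ[k] G.A2
  comm11 : ∀ x, G.r11 (eB1 x) = eA1 (F.r11 x)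
  comm22 : ∀ x, G.r22 (eB2 x) = eA2 (F.r22 x)
  comm31 : ∀ x, G.r31 (eB3 x) = eA1 (F.r31 x)
  comm32 : ∀ x, G.r32 (eB3 x) = eA2 (F.r32 x)

/-- The direct sum of two `k`-diagrams. -/
def sum (F G : KDiagram k) : KDiagram k where
  B1 := F.B1 × G.B1
  B2 := F.B2 × G.B2
  B3 := F.B3 × G.B3
  A1 := F.A1 × G.A1
  A2 := F.A2 × G.A2
  r11 := F.r11.prodMap G.r11
  r22 := F.r22.prodMap G.r22
  r31 := F.r31.prodMap G.r31
  r32 := F.r32.prodMap G.r32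

/-- The direct sum of a family of `k`-diagrams. -/
noncomputable def directSum {ι : Type} (F : ι → KDiagram k) : KDiagram k where
  B1 := ⨁ i, (F i).B1
  B2 := ⨁ i, (F i).B2
  B3 := ⨁ i, (F i).B3
  A1 := ⨁ i, (F i).A1
  A2 := ⨁ i, (F i).A2
  r11 := DirectSum.lmap fun i => (F i).r11
  r22 := DirectSum.lmap fun i => (F i).r22
  r31 := DirectSum.lmap fun i => (F i).r31
  r32 := DirectSum.lmap fun i => (F i).r32

/-- The multiset on `ℤ²` with multiplicities `W`. -/
def Multi (W : ℤ × ℤ → ℕ∞) : Type := {p : (ℤ × ℤ) × ℕ // 1 ≤ p.2 ∧ (p.2 : ℕ∞) ≤ W p.1}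

/-- The `k`-diagram `M_{W,d}`: `B_i = k^{⊕ ℤ_{≤ d_i}}` and `A_i = k^{⊕ ℤ}` for `i = 1, 2`, with
the inclusions, and `B_3 = k^{⊕ W}` with the two projections. -/
noncomputable def M (k : Type u) [Field k] (W : ℤ × ℤ → ℕ∞) (d : ℤ × ℤ) : KDiagram k where
  B1 := {i : ℤ // i ≤ d.1} →₀ k
  B2 := {j : ℤ // j ≤ d.2} →₀ k
  B3 := Multi W →₀ k
  A1 := ℤ →₀ k
  A2 := ℤ →₀ k
  r11 := Finsupp.lmapDomain k k Subtype.val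
  r22 := Finsupp.lmapDomain k k Subtype.val
  r31 := Finsupp.lmapDomain k k fun p : Multi W => p.1.1.1
  r32 := Finsupp.lmapDomain k k fun p : Multi W => p.1.1.2

/-- `M_{W,d}` for a non-negative integer valued `W`, such as a perfect matching. -/
noncomputable def MInt (k : Type u) [Field k] (W : ℤ × ℤ → ℤ) (d : ℤ × ℤ) : KDiagram k :=
  M k (fun a => ((W a).toNat : ℕ∞)) d

/-! ### Isomorphisms and direct sums -/

/-- The identity isomorphism. -/
def Iso.refl (F : KDiagram k) : Iso F F where
  eB1 := LinearEquiv.refl k _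
  eB2 := LinearEquiv.refl k _
  eB3 := LinearEquiv.refl k _
  eA1 := LinearEquiv.refl k _
  eA2 := LinearEquiv.refl k _
  comm11 _ := rfl
  comm22 _ := rfl
  comm31 _ := rfl
  comm32 _ := rfl

/-- The inverse isomorphism. -/
def Iso.symm {F G : KDiagram k} (e : Iso F G) : Iso G F where
  eB1 := e.eB1.symm
  eB2 := e.eB2.symm
  eB3 := e.eB3.symm
  eA1 := e.eA1.symm
  eA2 := e.eA2.symm
  comm11 x := by rw [LinearEquiv.eq_symm_apply, ← e.comm11, LinearEquiv.apply_symm_apply]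
  comm22 x := by rw [LinearEquiv.eq_symm_apply, ← e.comm22, LinearEquiv.apply_symm_apply]
  comm31 x := by rw [LinearEquiv.eq_symm_apply, ← e.comm31, LinearEquiv.apply_symm_apply]
  comm32 x := by rw [LinearEquiv.eq_symm_apply, ← e.comm32, LinearEquiv.apply_symm_apply]

/-- Composition of isomorphisms. -/
def Iso.trans {F G H : KDiagram k} (e : Iso F G) (e' : Iso G H) : Iso F H where
  eB1 := e.eB1.trans e'.eB1
  eB2 := e.eB2.trans e'.eB2
  eB3 := e.eB3.trans e'.eB3
  eA1 := e.eA1.trans e'.eA1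
  eA2 := e.eA2.trans e'.eA2
  comm11 x := by simp [e.comm11, e'.comm11]
  comm22 x := by simp [e.comm22, e'.comm22]
  comm31 x := by simp [e.comm31, e'.comm31]
  comm32 x := by simp [e.comm32, e'.comm32]

/-- The direct sum of two isomorphisms. -/
def Iso.sumCongr {F G F' G' : KDiagram k} (e : Iso F F') (e' : Iso G G') :
    Iso (F.sum G) (F'.sum G') where
  eB1 := e.eB1.prodCongr e'.eB1
  eB2 := e.eB2.prodCongr e'.eB2
  eB3 := e.eB3.prodCongr e'.eB3
  eA1 := e.eA1.prodCongr e'.eA1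
  eA2 := e.eA2.prodCongr e'.eA2
  comm11 x := Prod.ext (e.comm11 x.1) (e'.comm11 x.2)
  comm22 x := Prod.ext (e.comm22 x.1) (e'.comm22 x.2)
  comm31 x := Prod.ext (e.comm31 x.1) (e'.comm31 x.2)
  comm32 x := Prod.ext (e.comm32 x.1) (e'.comm32 x.2)

/-- `F ⊕ G ≃ G ⊕ F`. -/
def Iso.sumComm (F G : KDiagram k) : Iso (F.sum G) (G.sum F) where
  eB1 := LinearEquiv.prodComm k F.B1 G.B1
  eB2 := LinearEquiv.prodComm k F.B2 G.B2
  eB3 := LinearEquiv.prodComm k F.B3 G.B3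
  eA1 := LinearEquiv.prodComm k F.A1 G.A1
  eA2 := LinearEquiv.prodComm k F.A2 G.A2
  comm11 _ := rfl
  comm22 _ := rfl
  comm31 _ := rfl
  comm32 _ := rfl

/-- `(F ⊕ G) ⊕ H ≃ F ⊕ (G ⊕ H)`. -/
def Iso.sumAssoc (F G H : KDiagram k) : Iso ((F.sum G).sum H) (F.sum (G.sum H)) where
  eB1 := LinearEquiv.prodAssoc k F.B1 G.B1 H.B1
  eB2 := LinearEquiv.prodAssoc k F.B2 G.B2 H.B2
  eB3 := LinearEquiv.prodAssoc k F.B3 G.B3 H.B3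
  eA1 := LinearEquiv.prodAssoc k F.A1 G.A1 H.A1
  eA2 := LinearEquiv.prodAssoc k F.A2 G.A2 H.A2
  comm11 _ := rfl
  comm22 _ := rfl
  comm31 _ := rfl
  comm32 _ := rfl

/-- Being isomorphic, as an equivalence relation. -/
def isoSetoid (k : Type u) [Field k] : Setoid (KDiagram k) where
  r F G := Nonempty (Iso F G)
  iseqv :=
    { refl := fun F => ⟨Iso.refl F⟩
      symm := fun ⟨e⟩ => ⟨e.symm⟩
      trans := fun ⟨e⟩ ⟨e'⟩ => ⟨e.trans e'⟩ }

/-- Isomorphism classes of `k`-diagrams. -/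
def IsoClass (k : Type u) [Field k] : Type (u + 1) := Quotient (isoSetoid k)

/-- The isomorphism class of a `k`-diagram. -/
def toIsoClass (F : KDiagram k) : IsoClass k := Quotient.mk (isoSetoid k) F

theorem toIsoClass_eq_iff {F G : KDiagram k} :
    F.toIsoClass = G.toIsoClass ↔ Nonempty (Iso F G) := Quotient.eq

instance : AddCommSemigroup (IsoClass k) where
  add := Quotient.map₂ KDiagram.sum fun _ _ ⟨e⟩ _ _ ⟨e'⟩ => ⟨e.sumCongr e'⟩
  add_assoc := by
    rintro ⟨F⟩ ⟨G⟩ ⟨H⟩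
    exact Quotient.sound ⟨Iso.sumAssoc F G H⟩
  add_comm := by
    rintro ⟨F⟩ ⟨G⟩
    exact Quotient.sound ⟨Iso.sumComm F G⟩

theorem toIsoClass_sum (F G : KDiagram k) :
    (F.sum G).toIsoClass = F.toIsoClass + G.toIsoClass := rfl

/-! ### Cohomology of isomorphic diagrams and of direct sums -/

/-- An isomorphism of diagrams induces an isomorphism on `H⁰`. -/
def Iso.H0Equiv {F G : KDiagram k} (e : Iso F G) : F.H0 ≃ₗ[k] G.H0 :=
  (e.eB1.prodCongr (e.eB2.prodCongr e.eB3)).ofSubmodules _ _ (by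
    ext y
    obtain ⟨⟨x1, x2, x3⟩, rfl⟩ := (e.eB1.prodCongr (e.eB2.prodCongr e.eB3)).surjective y
    simp only [Submodule.mem_map, LinearMap.mem_ker, differential_apply, Prod.mk_eq_zero]
    constructor
    · rintro ⟨x, ⟨h1, h2⟩, hx⟩
      have hx' := (e.eB1.prodCongr (e.eB2.prodCongr e.eB3)).injective hx
      subst hx'
      simp only [LinearEquiv.prodCongr_apply, e.comm11, e.comm22, e.comm31, e.comm32, ← map_sub]
      exact ⟨by rw [h1, map_zero], by rw [h2, map_zero]⟩
    · intro h
      simp only [LinearEquiv.prodCongr_apply, e.comm11, e.comm22, e.comm31, e.comm32,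
        ← map_sub, LinearEquiv.map_eq_zero_iff] at h
      exact ⟨_, h, rfl⟩)

/-- An isomorphism of diagrams induces an isomorphism on `H¹`. -/
def Iso.H1Equiv {F G : KDiagram k} (e : Iso F G) : F.H1 ≃ₗ[k] G.H1 :=
  Submodule.Quotient.equiv _ _ (e.eA1.prodCongr e.eA2) (by
    ext y
    simp only [Submodule.mem_map, LinearMap.mem_range]
    constructor
    · rintro ⟨_, ⟨x, rfl⟩, rfl⟩
      refine ⟨(e.eB1 x.1, e.eB2 x.2.1, e.eB3 x.2.2), ?_⟩
      simp [differential_apply, e.comm11, e.comm22, e.comm31, e.comm32]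
    · rintro ⟨x, rfl⟩
      refine ⟨_, ⟨(e.eB1.symm x.1, e.eB2.symm x.2.1, e.eB3.symm x.2.2), rfl⟩, ?_⟩
      simp [differential_apply, ← e.comm11, ← e.comm22, ← e.comm31, ← e.comm32])

/-- `H⁰` commutes with direct sums. -/
def H0Sum (F G : KDiagram k) : (F.sum G).H0 ≃ₗ[k] F.H0 × G.H0 where
  toFun x := (⟨(x.1.1.1, x.1.2.1.1, x.1.2.2.1), by
      have h := x.2
      rw [LinearMap.mem_ker, differential_apply, Prod.mk_eq_zero] at h ⊢
      exact ⟨congrArg Prod.fst h.1, congrArg Prod.fst h.2⟩⟩,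
    ⟨(x.1.1.2, x.1.2.1.2, x.1.2.2.2), by
      have h := x.2
      rw [LinearMap.mem_ker, differential_apply, Prod.mk_eq_zero] at h ⊢
      exact ⟨congrArg Prod.snd h.1, congrArg Prod.snd h.2⟩⟩)
  map_add' _ _ := rfl
  map_smul' _ _ := rfl
  invFun y := ⟨((y.1.1.1, y.2.1.1), (y.1.1.2.1, y.2.1.2.1), (y.1.1.2.2, y.2.1.2.2)), by
      have h := y.1.2
      have h' := y.2.2
      rw [LinearMap.mem_ker, differential_apply, Prod.mk_eq_zero] at h h' ⊢
      exact ⟨Prod.ext h.1 h'.1, Prod.ext h.2 h'.2⟩⟩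
  left_inv _ := rfl
  right_inv _ := rfl

/-- The map from the target of the differential of `F ⊕ G` to `H¹(F) ⊕ H¹(G)`. -/
def H1SumMap (F G : KDiagram k) :
    ((F.sum G).A1 × (F.sum G).A2) →ₗ[k] F.H1 × G.H1 :=
  ((Submodule.mkQ _).prodMap (Submodule.mkQ _)) ∘ₗ
    (LinearEquiv.prodProdProdComm k F.A1 G.A1 F.A2 G.A2).toLinearMap

/-- `H¹` commutes with direct sums. -/
noncomputable def H1Sum (F G : KDiagram k) : (F.sum G).H1 ≃ₗ[k] F.H1 × G.H1 :=
  (Submodule.quotEquivOfEq _ _ (by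
    ext y
    have key : y ∈ LinearMap.ker (H1SumMap F G) ↔
        (y.1.1, y.2.1) ∈ LinearMap.range F.differential ∧
          (y.1.2, y.2.2) ∈ LinearMap.range G.differential := by
      rw [LinearMap.mem_ker, ← Submodule.Quotient.mk_eq_zero, ← Submodule.Quotient.mk_eq_zero]
      exact Prod.ext_iff
    rw [key]
    constructor
    · rintro ⟨x, rfl⟩
      exact ⟨⟨(x.1.1, x.2.1.1, x.2.2.1), rfl⟩, ⟨(x.1.2, x.2.1.2, x.2.2.2), rfl⟩⟩
    · rintro ⟨⟨x, hx⟩, ⟨x', hx'⟩⟩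
      refine ⟨((x.1, x'.1), (x.2.1, x'.2.1), (x.2.2, x'.2.2)), ?_⟩
      rw [differential_apply, Prod.ext_iff] at hx hx'
      exact Prod.ext (Prod.ext hx.1 hx'.1) (Prod.ext hx.2 hx'.2))).trans
  (LinearMap.quotKerEquivOfSurjective (H1SumMap F G)
    ((Function.Surjective.prodMap (Submodule.mkQ_surjective _) (Submodule.mkQ_surjective _)).comp
      (LinearEquiv.surjective _)))

theorem IsFredholm.sum {F G : KDiagram k} (hF : F.IsFredholm) (hG : G.IsFredholm) :
    (F.sum G).IsFredholm := by
  have := hF.1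
  have := hF.2
  have := hG.1
  have := hG.2
  exact ⟨Module.Finite.equiv (H0Sum F G).symm, Module.Finite.equiv (H1Sum F G).symm⟩

theorem b0_sum {F G : KDiagram k} (hF : F.IsFredholm) (hG : G.IsFredholm) :
    (F.sum G).b0 = F.b0 + G.b0 := by
  have := hF.1
  have := hG.1
  exact (H0Sum F G).finrank_eq.trans Module.finrank_prod

theorem b1_sum {F G : KDiagram k} (hF : F.IsFredholm) (hG : G.IsFredholm) :
    (F.sum G).b1 = F.b1 + G.b1 := by
  have := hF.2
  have := hG.2
  exact (H1Sum F G).finrank_eq.trans Module.finrank_prod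

theorem Iso.b0_eq {F G : KDiagram k} (e : Iso F G) : F.b0 = G.b0 := e.H0Equiv.finrank_eq

theorem Iso.b1_eq {F G : KDiagram k} (e : Iso F G) : F.b1 = G.b1 := e.H1Equiv.finrank_eq

theorem IsFredholm.directSum {ι : Type} [Finite ι] {F : ι → KDiagram k}
    (hF : ∀ i, (F i).IsFredholm) : (directSum F).IsFredholm := by
  classical
  have := Fintype.ofFinite ι
  have h0 := fun i => (hF i).1
  have h1 := fun i => (hF i).2
  constructor
  · let φ : (KDiagram.directSum F).H0 →ₗ[k] (∀ i, (F i).H0) :=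
      LinearMap.pi fun i => LinearMap.codRestrict _
        (((DirectSum.component k ι (fun i => (F i).B1) i).prodMap
          ((DirectSum.component k ι (fun i => (F i).B2) i).prodMap
            (DirectSum.component k ι (fun i => (F i).B3) i))) ∘ₗ Submodule.subtype _)
        (by
          intro x
          have h := x.2
          rw [LinearMap.mem_ker, differential_apply, Prod.mk_eq_zero] at h ⊢
          exact ⟨congrArg (DirectSum.component k ι (fun i => (F i).A1) i) h.1,
            congrArg (DirectSum.component k ι (fun i => (F i).A2) i) h.2⟩)
    refine Module.Finite.of_injective φ ?_
    intro x y hxy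
    have h := fun i => congrArg Subtype.val (congrFun hxy i)
    refine Subtype.ext (Prod.ext ?_ (Prod.ext ?_ ?_))
    · exact DFinsupp.ext fun i => congrArg Prod.fst (h i)
    · exact DFinsupp.ext fun i => congrArg (fun z => z.2.1) (h i)
    · exact DFinsupp.ext fun i => congrArg (fun z => z.2.2) (h i)
  · let ψ : ((KDiagram.directSum F).A1 × (KDiagram.directSum F).A2) →ₗ[k] (∀ i, (F i).H1) :=
      LinearMap.pi fun i => Submodule.mkQ _ ∘ₗ
        ((DirectSum.component k ι (fun i => (F i).A1) i).prodMap
          (DirectSum.component k ι (fun i => (F i).A2) i))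
    have hker : LinearMap.ker ψ ≤ LinearMap.range (KDiagram.directSum F).differential := by
      intro y hy
      have hy' : ∀ i, ∃ x, (F i).differential x =
          (DirectSum.component k ι (fun i => (F i).A1) i y.1,
            DirectSum.component k ι (fun i => (F i).A2) i y.2) := fun i =>
        (Submodule.Quotient.mk_eq_zero _).1 (congrFun (LinearMap.mem_ker.1 hy) i)
      choose x hx using hy'
      refine ⟨(DFinsupp.equivFunOnFintype.symm fun i => (x i).1,
        DFinsupp.equivFunOnFintype.symm fun i => (x i).2.1,
        DFinsupp.equivFunOnFintype.symm fun i => (x i).2.2), ?_⟩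
      exact Prod.ext (DFinsupp.ext fun i => congrArg Prod.fst (hx i))
        (DFinsupp.ext fun i => congrArg Prod.snd (hx i))
    have : Module.Finite k (((KDiagram.directSum F).A1 × (KDiagram.directSum F).A2) ⧸
        LinearMap.ker ψ) :=
      Module.Finite.equiv ψ.quotKerEquivRange.symm
    exact Module.Finite.of_surjective (Submodule.factor hker) (Submodule.factor_surjective hker)

/-! ### `M_{W,d}` is Fredholm for a perfect matching `W` -/

theorem isFredholm_MInt (k : Type u) [Field k] {W : ℤ × ℤ → ℤ} (hW : IsPerfectMatching W)
    (d : ℤ × ℤ) : (MInt k W d).IsFredholm := by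
  classical
  obtain ⟨⟨a, ha⟩, ⟨b, hb⟩, π, hπ⟩ := hW
  let V : ℤ × ℤ → ℕ∞ := fun c => ((W c).toNat : ℕ∞)
  have hle : ∀ i, a ≤ i + π i := fun i => by
    by_contra h
    have := ha (i, π i) (by simp only [deg]; omega)
    simp [hπ] at this
  have hge : ∀ i, i + π i ≤ b := fun i => by
    by_contra h
    have := hb (i, π i) (by simp only [deg]; omega)
    simp [hπ] at this
  have hp : ∀ p : Multi V, p.1.1.2 = π p.1.1.1 ∧ p.1.2 = 1 := by
    rintro ⟨⟨⟨i, j⟩, n⟩, h1, h2⟩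
    have h3 : n ≤ (W (i, j)).toNat := by
      have h2' : (n : ℕ∞) ≤ ((W (i, j)).toNat : ℕ∞) := h2
      exact_mod_cast h2'
    rw [hπ] at h3
    dsimp only at h1 ⊢
    split_ifs at h3 with h
    · exact ⟨h, by simp at h3; omega⟩
    · simp at h3; omega
  have hinj : Function.Injective fun p : Multi V => p.1.1.1 := by
    intro p q h
    have hq := hp q
    have hp := hp p
    dsimp only at h
    refine Subtype.ext (Prod.ext (Prod.ext h ?_) ?_)
    · rw [hp.1, hq.1, h]
    · rw [hp.2, hq.2]
  let m : ℤ → Multi V := fun i => ⟨((i, π i), 1), le_rfl, by simp [V, hπ]⟩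
  obtain ⟨T, hdiff, hfin⟩ : ∃ T : (({i : ℤ // i ≤ d.1} →₀ k) × ({j : ℤ // j ≤ d.2} →₀ k) ×
      (Multi V →₀ k)) →ₗ[k] ((ℤ →₀ k) × (ℤ →₀ k)), (∀ x, T x =
      (Finsupp.mapDomain Subtype.val x.1 - Finsupp.mapDomain (fun p : Multi V => p.1.1.1) x.2.2,
        Finsupp.mapDomain Subtype.val x.2.1 -
          Finsupp.mapDomain (fun p : Multi V => p.1.1.2) x.2.2)) ∧
      (Module.Finite k (LinearMap.ker T) ∧
        Module.Finite k (((ℤ →₀ k) × (ℤ →₀ k)) ⧸ LinearMap.range T) → (M k V d).IsFredholm) :=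
    ⟨(M k V d).differential, fun _ => rfl, fun h => h⟩
  refine hfin ?_
  have hsub : ∀ c : ℤ, ∀ x : {i : ℤ // i ≤ c} →₀ k, ∀ j, c < j →
      Finsupp.mapDomain Subtype.val x j = 0 := by
    intro c x j hj
    refine Finsupp.mapDomain_of_notMem_range _ _ ?_
    rintro ⟨y, rfl⟩
    exact absurd y.2 (not_le.2 hj)
  have hinj2 : Function.Injective fun p : Multi V => p.1.1.2 := by
    intro p q h
    have hq := (hp q).1
    have hp := (hp p).1
    dsimp only at h
    exact hinj (π.injective (by dsimp only; rw [← hp, ← hq, h]))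
  constructor
  · let S : Finset ℤ := Finset.Icc (a - d.2) d.1
    let φ : LinearMap.ker T →ₗ[k] (S → k) :=
      LinearMap.pi fun i => (Finsupp.lapply (m i)) ∘ₗ (LinearMap.snd k _ _ ∘ₗ
        LinearMap.snd k _ _) ∘ₗ Submodule.subtype _
    suffices hφ : ∀ x, φ x = 0 → x = 0 from Module.Finite.of_injective φ fun x y h =>
      sub_eq_zero.1 (hφ (x - y) ((φ.map_sub x y).trans (sub_eq_zero.2 h)))
    rintro ⟨⟨x1, x2, x3⟩, hx⟩ h
    rw [LinearMap.mem_ker, hdiff, Prod.mk_eq_zero, sub_eq_zero, sub_eq_zero] at hx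
    dsimp only at hx
    have h3 : x3 = 0 := by
      refine Finsupp.ext fun (p : Multi V) => ?_
      have e1 := DFunLike.congr_fun hx.1 p.1.1.1
      have e2 := DFunLike.congr_fun hx.2 p.1.1.2
      have q1 : Finsupp.mapDomain (fun p : Multi V => p.1.1.1) x3 p.1.1.1 = x3 p :=
        Finsupp.mapDomain_apply hinj x3 p
      have q2 : Finsupp.mapDomain (fun p : Multi V => p.1.1.2) x3 p.1.1.2 = x3 p :=
        Finsupp.mapDomain_apply hinj2 x3 p
      rw [q1] at e1
      rw [q2] at e2
      by_cases hc1 : d.1 < p.1.1.1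
      · exact e1.symm.trans (hsub _ _ _ hc1)
      by_cases hc2 : d.2 < p.1.1.2
      · exact e2.symm.trans (hsub _ _ _ hc2)
      have hpm : p = m p.1.1.1 := hinj rfl
      have hmem : p.1.1.1 ∈ S := by
        have := hle p.1.1.1
        have := (hp p).1
        simp only [S, Finset.mem_Icc]
        omega
      rw [hpm]
      exact congrFun h ⟨p.1.1.1, hmem⟩
    subst h3
    have h1 : x1 = 0 := Finsupp.mapDomain_injective Subtype.val_injective
      (hx.1.trans (by simp only [Finsupp.mapDomain_zero]))
    have h2 : x2 = 0 := Finsupp.mapDomain_injective Subtype.val_injective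
      (hx.2.trans (by simp only [Finsupp.mapDomain_zero]))
    subst h1 h2
    rfl
  · let S : Finset ℤ := Finset.Icc (d.1 + 1) (b - d.2)
    let R := LinearMap.range T
    let φ : (S → k) →ₗ[k] ((ℤ →₀ k) × (ℤ →₀ k)) ⧸ R :=
      (Fintype.linearCombination k fun i : S =>
        R.mkQ ((Finsupp.single (i : ℤ) (1 : k), 0) : (ℤ →₀ k) × (ℤ →₀ k)))
    have hA1 : ∀ i : ℤ,
        R.mkQ ((Finsupp.single i (1 : k), 0) : (ℤ →₀ k) × (ℤ →₀ k)) ∈ LinearMap.range φ := by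
      intro i
      by_cases h1 : i ≤ d.1
      · have : R.mkQ ((Finsupp.single i (1 : k), 0) : (ℤ →₀ k) × (ℤ →₀ k)) = 0 := by
          refine (Submodule.Quotient.mk_eq_zero _).2 ⟨(Finsupp.single ⟨i, h1⟩ 1, 0, 0), ?_⟩
          rw [hdiff]
          simp
        rw [this]
        exact zero_mem _
      by_cases h2 : π i ≤ d.2
      · have : R.mkQ ((Finsupp.single i (1 : k), 0) : (ℤ →₀ k) × (ℤ →₀ k)) = 0 := by
          refine (Submodule.Quotient.mk_eq_zero _).2
            ⟨(0, Finsupp.single ⟨π i, h2⟩ (-1), Finsupp.single (m i) (-1)), ?_⟩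
          rw [hdiff]
          simp only [Finsupp.mapDomain_single, Finsupp.mapDomain_zero]
          simp [m]
        rw [this]
        exact zero_mem _
      · have hi : i ∈ S := by
          have := hge i
          simp only [S, Finset.mem_Icc]
          omega
        exact ⟨Pi.single ⟨i, hi⟩ 1, by simp [φ]⟩
    have hA2 : ∀ j : ℤ,
        R.mkQ ((0, Finsupp.single j (1 : k)) : (ℤ →₀ k) × (ℤ →₀ k)) ∈ LinearMap.range φ := by
      intro j
      have : R.mkQ ((0, Finsupp.single j (1 : k)) : (ℤ →₀ k) × (ℤ →₀ k)) =
          - R.mkQ ((Finsupp.single (π.symm j) (1 : k), 0) : (ℤ →₀ k) × (ℤ →₀ k)) := by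
        rw [eq_neg_iff_add_eq_zero, ← map_add]
        refine (Submodule.Quotient.mk_eq_zero _).2
            ⟨(0, 0, Finsupp.single (m (π.symm j)) (-1)), ?_⟩
        rw [hdiff]
        simp only [Finsupp.mapDomain_single, Finsupp.mapDomain_zero]
        simp [m]
      rw [this]
      exact neg_mem (hA1 _)
    refine Module.Finite.of_surjective φ (LinearMap.range_eq_top.1 (eq_top_iff.2 ?_))
    rintro y -
    obtain ⟨⟨y1, y2⟩, rfl⟩ := Submodule.mkQ_surjective _ y
    have e1 : ∀ y1 : ℤ →₀ k,
        R.mkQ ((y1, 0) : (ℤ →₀ k) × (ℤ →₀ k)) ∈ LinearMap.range φ := by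
      intro y1
      induction y1 using Finsupp.induction_linear with
      | zero => exact zero_mem _
      | add f g hf hg =>
        have := add_mem hf hg
        rw [← map_add] at this
        simpa using this
      | single i c =>
        have := Submodule.smul_mem _ c (hA1 i)
        rw [← map_smul] at this
        simpa using this
    have e2 : ∀ y2 : ℤ →₀ k,
        R.mkQ ((0, y2) : (ℤ →₀ k) × (ℤ →₀ k)) ∈ LinearMap.range φ := by
      intro y2
      induction y2 using Finsupp.induction_linear with
      | zero => exact zero_mem _
      | add f g hf hg =>
        have := add_mem hf hg
        rw [← map_add] at this
        simpa using this
      | single i c =>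
        have := Submodule.smul_mem _ c (hA2 i)
        rw [← map_smul] at this
        simpa using this
    have := add_mem (e1 y1) (e2 y2)
    rw [← map_add] at this
    simpa using this

end KDiagram

/-! ### Virtual Fredholm `k`-diagrams -/

/-- Fredholm `k`-diagrams. -/
def FredholmDiagram (k : Type u) [Field k] : Type (u + 1) := {F : KDiagram k // F.IsFredholm}

/-- A virtual (Fredholm) `k`-diagram: a formal difference `pos ⊖ neg` of Fredholm `k`-diagrams. -/
structure VirtualDiagram (k : Type u) [Field k] where
  pos : FredholmDiagram k
  neg : FredholmDiagram k

namespace VirtualDiagram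

variable {k : Type u} [Field k]

/-- `(F₁, F₂) ∼ (F₁', F₂')` iff `F₁ ⊕ F₂' ⊕ F₀ ≃ F₁' ⊕ F₂ ⊕ F₀` for some Fredholm `F₀`. -/
def Equivalent (X Y : VirtualDiagram k) : Prop :=
  ∃ F0 : FredholmDiagram k, Nonempty (KDiagram.Iso
    ((X.pos.1.sum Y.neg.1).sum F0.1) ((Y.pos.1.sum X.neg.1).sum F0.1))

theorem equivalent_trans {X Y Z : VirtualDiagram k} (h : Equivalent X Y) (h' : Equivalent Y Z) :
    Equivalent X Z := by
  obtain ⟨F, e⟩ := h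
  obtain ⟨G, e'⟩ := h'
  refine ⟨⟨(Y.neg.1.sum F.1).sum (Y.pos.1.sum G.1),
    (Y.neg.2.sum F.2).sum (Y.pos.2.sum G.2)⟩, ?_⟩
  rw [← KDiagram.toIsoClass_eq_iff] at e e' ⊢
  simp only [KDiagram.toIsoClass_sum] at e e' ⊢
  generalize X.pos.1.toIsoClass = a at *
  generalize X.neg.1.toIsoClass = b at *
  generalize Y.pos.1.toIsoClass = c at *
  generalize Y.neg.1.toIsoClass = p at *
  generalize Z.pos.1.toIsoClass = q at *
  generalize Z.neg.1.toIsoClass = r at *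
  generalize F.1.toIsoClass = s at *
  generalize G.1.toIsoClass = t at *
  calc a + r + (p + s + (c + t)) = (a + p + s) + (c + r + t) := by ac_rfl
    _ = (c + b + s) + (q + p + t) := by rw [e, e']
    _ = q + b + (p + s + (c + t)) := by ac_rfl

/-- Equivalence of virtual diagrams as a setoid. -/
instance setoid (k : Type u) [Field k] : Setoid (VirtualDiagram k) where
  r := Equivalent
  iseqv :=
    { refl := fun X => ⟨X.pos, ⟨KDiagram.Iso.refl _⟩⟩
      symm := fun ⟨F, ⟨e⟩⟩ => ⟨F, ⟨e.symm⟩⟩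
      trans := equivalent_trans }

/-- `b⁰(F₁ ⊖ F₂) = b⁰(F₁) - b⁰(F₂)`. -/
noncomputable def b0 (X : VirtualDiagram k) : ℤ := (X.pos.1.b0 : ℤ) - X.neg.1.b0

/-- `b¹(F₁ ⊖ F₂) = b¹(F₁) - b¹(F₂)`. -/
noncomputable def b1 (X : VirtualDiagram k) : ℤ := (X.pos.1.b1 : ℤ) - X.neg.1.b1

theorem b0_eq_of_equivalent (X Y : VirtualDiagram k) (h : Equivalent X Y) : X.b0 = Y.b0 := by
  obtain ⟨F, ⟨e⟩⟩ := h
  have := e.b0_eq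
  rw [KDiagram.b0_sum (X.pos.2.sum Y.neg.2) F.2, KDiagram.b0_sum X.pos.2 Y.neg.2,
    KDiagram.b0_sum (Y.pos.2.sum X.neg.2) F.2, KDiagram.b0_sum Y.pos.2 X.neg.2] at this
  simp only [b0]
  omega

theorem b1_eq_of_equivalent (X Y : VirtualDiagram k) (h : Equivalent X Y) : X.b1 = Y.b1 := by
  obtain ⟨F, ⟨e⟩⟩ := h
  have := e.b1_eq
  rw [KDiagram.b1_sum (X.pos.2.sum Y.neg.2) F.2, KDiagram.b1_sum X.pos.2 Y.neg.2,
    KDiagram.b1_sum (Y.pos.2.sum X.neg.2) F.2, KDiagram.b1_sum Y.pos.2 X.neg.2] at this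
  simp only [b1]
  omega

end VirtualDiagram

/-- Equivalence classes of virtual Fredholm `k`-diagrams. -/
def VirtualClass (k : Type u) [Field k] : Type (u + 1) := Quotient (VirtualDiagram.setoid k)

namespace VirtualClass

variable {k : Type u} [Field k]

/-- The zeroth Betti number of a class of virtual Fredholm `k`-diagrams. -/
noncomputable def b0 (c : VirtualClass k) : ℤ :=
  Quotient.lift VirtualDiagram.b0 VirtualDiagram.b0_eq_of_equivalent c

/-- The first Betti number of a class of virtual Fredholm `k`-diagrams. -/
noncomputable def b1 (c : VirtualClass k) : ℤ :=
  Quotient.lift VirtualDiagram.b1 VirtualDiagram.b1_eq_of_equivalent c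

/-- The Euler characteristic of a class of virtual Fredholm `k`-diagrams. -/
noncomputable def eulerChar (c : VirtualClass k) : ℤ := c.b0 - c.b1

end VirtualClass

namespace MatchingDecomposition

/-- The virtual Fredholm `k`-diagram
`(M_{W_1,d} ⊕ ⋯ ⊕ M_{W_s,d}) ⊖ (M_{W̃_1,d} ⊕ ⋯ ⊕ M_{W̃_{s-1},d})`. -/
noncomputable def virtualDiagram {W : ℤ × ℤ → ℤ} (D : MatchingDecomposition W)
    (k : Type u) [Field k] (d : ℤ × ℤ) : VirtualDiagram k where
  pos := ⟨KDiagram.directSum fun i => KDiagram.MInt k (D.pos i) d,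
    KDiagram.IsFredholm.directSum fun i => KDiagram.isFredholm_MInt k (D.pos_matching i) d⟩
  neg := ⟨KDiagram.directSum fun i => KDiagram.MInt k (D.neg i) d,
    KDiagram.IsFredholm.directSum fun i => KDiagram.isFredholm_MInt k (D.neg_matching i) d⟩

/-- The class `[M_{W,d}]` obtained from a given way of writing `W`. -/
noncomputable def virtualClass {W : ℤ × ℤ → ℤ} (D : MatchingDecomposition W)
    (k : Type u) [Field k] (d : ℤ × ℤ) : VirtualClass k :=
  Quotient.mk (VirtualDiagram.setoid k) (D.virtualDiagram k d)

end MatchingDecomposition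

/-! The diagram `M_{W,d}` of a perfect matching `W` splits into elementary diagrams, one for each
point `c` of the matching, with at most a line in each of the five spaces. Such a diagram
contributes to `b⁰` exactly if `c ≤ d`, and to `b¹` exactly if both coordinates of `c` exceed those
of `d`. Direct sums add up the multiplicities of the points, and these determine the diagram up to
isomorphism. Hence moving the subtracted matchings to the other side shows that the class of a
signed sum of matchings depends only on its total multiplicity function `W`, and gives
`b⁰ = ∑_{c ≤ d} W c = f d` and `b¹ = ∑ W c`, summed over the open quadrant above `d`.
Inclusion–exclusion in a box whose other three corners have degree so large that `f = deg + C` there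
evaluates the latter sum as `f d - deg d - C`, which is the value of the dual function. -/

section Degree

theorem InitiallyZero.sum {ι : Type*} [Fintype ι] {V : ι → ℤ × ℤ → ℤ}
    (hV : ∀ i, InitiallyZero (V i)) : InitiallyZero (∑ i, V i) := by
  choose a ha using hV
  obtain ⟨a₀, ha₀⟩ := Finite.exists_ge a
  refine ⟨a₀, fun c hc => ?_⟩
  rw [Finset.sum_apply]
  exact Finset.sum_eq_zero fun i _ => ha i c (hc.trans (ha₀ i))

theorem EventuallyZero.sum {ι : Type*} [Fintype ι] {V : ι → ℤ × ℤ → ℤ}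
    (hV : ∀ i, EventuallyZero (V i)) : EventuallyZero (∑ i, V i) := by
  choose b hb using hV
  obtain ⟨b₀, hb₀⟩ := Finite.exists_le b
  refine ⟨b₀, fun c hc => ?_⟩
  rw [Finset.sum_apply]
  exact Finset.sum_eq_zero fun i _ => hb i c ((hb₀ i).trans hc)

open Set in
theorem InitiallyZero.finite_Iic_inter_support {V : ℤ × ℤ → ℤ} (hV : InitiallyZero V)
    (d : ℤ × ℤ) : (Iic d ∩ Function.support V).Finite := by
  obtain ⟨a, ha⟩ := hV
  refine (finite_Icc ((a - d.2, a - d.1) : ℤ × ℤ) d).subset fun c ⟨hcd, hc⟩ => ?_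
  have hac : a < deg c := not_le.1 fun h => hc (ha c h)
  simp only [deg, mem_Iic, mem_Icc, Prod.le_def] at hac hcd ⊢
  omega

/-- The points that lie strictly above and strictly to the right of `d`. Beware that `Set.Ioi d` is
larger: it also contains the points sharing one coordinate with `d`. -/
def openQuadrant (d : ℤ × ℤ) : Set (ℤ × ℤ) := Set.Ioi d.1 ×ˢ Set.Ioi d.2

theorem mem_openQuadrant {c d : ℤ × ℤ} : c ∈ openQuadrant d ↔ d.1 < c.1 ∧ d.2 < c.2 := Iff.rfl

open Set in
theorem EventuallyZero.finite_openQuadrant_inter_support {V : ℤ × ℤ → ℤ} (hV : EventuallyZero V)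
    (d : ℤ × ℤ) : (openQuadrant d ∩ Function.support V).Finite := by
  obtain ⟨b, hb⟩ := hV
  refine (finite_Icc d ((b - d.2, b - d.1) : ℤ × ℤ)).subset fun c ⟨hdc, hc⟩ => ?_
  have hcb : deg c < b := not_le.1 fun h => hc (hb c h)
  simp only [deg, mem_openQuadrant, mem_Icc, Prod.le_def] at hcb hdc ⊢
  omega

end Degree

section Weight

open Set

variable {f W : ℤ × ℤ → ℤ}

theorem Iic_inter_openQuadrant (d e : ℤ × ℤ) :
    Iic e ∩ openQuadrant d = Iic e \ (Iic (d.1, e.2) ∪ Iic (e.1, d.2)) := by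
  ext c
  simp only [mem_inter_iff, mem_sdiff, mem_union, mem_Iic, mem_openQuadrant, Prod.le_def]
  omega

theorem IsWeight.finsum_mem_Iic_inter_openQuadrant (hW : IsWeight f W) {d e : ℤ × ℤ}
    (hde : d ≤ e) : ∑ᶠ c ∈ Iic e ∩ openQuadrant d, W c =
      f e - f (d.1, e.2) - f (e.1, d.2) + f d := by
  have fin : ∀ c, (Iic c ∩ Function.support W).Finite := hW.1.finite_Iic_inter_support
  have corner : Iic (d.1, e.2) ∩ Iic (e.1, d.2) = Iic d := by
    ext c
    simp only [mem_inter_iff, mem_Iic, Prod.le_def] at hde ⊢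
    omega
  have strips : Iic e ∩ (Iic (d.1, e.2) ∪ Iic (e.1, d.2)) = Iic (d.1, e.2) ∪ Iic (e.1, d.2) :=
    inter_eq_right.2 (union_subset (Iic_subset_Iic.2 ⟨hde.1, le_rfl⟩)
      (Iic_subset_Iic.2 ⟨le_rfl, hde.2⟩))
  have h_sdiff := finsum_mem_inter_add_sdiff' (Iic (d.1, e.2) ∪ Iic (e.1, d.2)) (fin e)
  have h_union := finsum_mem_union_inter' (fin (d.1, e.2)) (fin (e.1, d.2))
  rw [strips, ← Iic_inter_openQuadrant, ← hW.2] at h_sdiff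
  rw [corner, ← hW.2, ← hW.2, ← hW.2] at h_union
  linarith

theorem IsWeight.eq_alternating_sum (hW : IsWeight f W) (c : ℤ × ℤ) :
    W c = f c - f (c.1 - 1, c.2) - f (c.1, c.2 - 1) + f (c - 1) := by
  have cell : Iic c ∩ openQuadrant (c - 1) = {c} := by
    ext c'
    simp only [mem_inter_iff, mem_Iic, mem_openQuadrant, mem_singleton_iff, Prod.le_def,
      Prod.ext_iff, Prod.fst_sub, Prod.snd_sub, Prod.fst_one, Prod.snd_one]
    omega
  have h := hW.finsum_mem_Iic_inter_openQuadrant (sub_le_self c (by decide : (0 : ℤ × ℤ) ≤ 1))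
  rwa [cell, finsum_mem_singleton] at h

theorem IsWeight.eventuallyZero {C : ℤ} (hf : IsRiemannFunction f C) (hW : IsWeight f W) :
    EventuallyZero W := by
  obtain ⟨-, b, hb⟩ := hf
  refine ⟨b + 2, fun c hc => ?_⟩
  rw [deg] at hc
  rw [hW.eq_alternating_sum, hb c, hb (_, _), hb (_, _), hb (c - 1)] <;>
    simp only [deg, Prod.fst_sub, Prod.snd_sub, Prod.fst_one, Prod.snd_one] <;> omega

theorem IsWeight.finsum_mem_openQuadrant {C : ℤ} (hf : IsRiemannFunction f C)
    (hW : IsWeight f W) (d : ℤ × ℤ) :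
    ∑ᶠ c ∈ openQuadrant d, W c = f d - deg d - C := by
  obtain ⟨B, hB⟩ := hW.eventuallyZero hf
  obtain ⟨-, b, hb⟩ := hf
  obtain ⟨n, hn, hnb, hnB⟩ : ∃ n : ℤ, 0 ≤ n ∧ b ≤ deg d + n ∧ B ≤ deg d + n :=
    ⟨max 0 (max (b - deg d) (B - deg d)), by omega, by omega, by omega⟩
  rw [deg] at hnb hnB
  have supp : openQuadrant d ∩ Function.support W ⊆ Iic (d + (n, n)) := fun c ⟨hdc, hc⟩ => by
    have hcB : deg c < B := not_le.1 fun h => hc (hB c h)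
    simp only [deg, mem_openQuadrant] at hdc hcB
    constructor <;> simp only [Prod.fst_add, Prod.snd_add] <;> omega
  have box : ∑ᶠ c ∈ openQuadrant d, W c = ∑ᶠ c ∈ Iic (d + (n, n)) ∩ openQuadrant d, W c :=
    (finsum_mem_inter_support_eq' W _ _ fun c hc =>
      ⟨fun h => ⟨supp ⟨h, hc⟩, h⟩, fun h => h.2⟩)
  rw [box, hW.finsum_mem_Iic_inter_openQuadrant (le_add_of_nonneg_right ⟨hn, hn⟩),
    hb (d + (n, n)), hb (_, _), hb (_, _)] <;>
    simp only [deg, Prod.fst_add, Prod.snd_add] <;> omega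

theorem IsWeight.dualFunction_sub {C : ℤ} (hf : IsRiemannFunction f C) (hW : IsWeight f W)
    (K d : ℤ × ℤ) :
    dualFunction f C K (K - d) = ∑ᶠ c ∈ openQuadrant d, W c := by
  rw [hW.finsum_mem_openQuadrant hf, dualFunction, sub_sub_cancel]

end Weight

section Multiplicity

/-- The family `p : ι → γ` realises the multiplicity function `V`: every point `c` has exactly `V c`
preimages under `p`. In particular `V` is non-negative and all fibres of `p` are finite. -/
def Enumerates {ι γ : Type*} (p : ι → γ) (V : γ → ℤ) : Prop :=
  ∀ c, Finite {x // p x = c} ∧ (Nat.card {x // p x = c} : ℤ) = V c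

/-- The analogue of `Equiv.subtypeSum` for `Σ`-types. -/
def subtypeSigmaEquivSigmaSubtype {α : Type*} {X : α → Type*} (q : ∀ a, X a → Prop) :
    {y : Σ a, X a // q y.1 y.2} ≃ Σ a, {x // q a x} where
  toFun y := ⟨y.1.1, y.1.2, y.2⟩
  invFun z := ⟨⟨z.1, z.2.1⟩, z.2.2⟩
  left_inv _ := rfl
  right_inv _ := rfl

namespace Enumerates

variable {ι ι' γ : Type*} {p : ι → γ} {p' : ι' → γ} {V V' : γ → ℤ}

theorem sum (h : Enumerates p V) (h' : Enumerates p' V') :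
    Enumerates (Sum.elim p p') (V + V') := fun c => by
  have := (h c).1
  have := (h' c).1
  let e : {x // Sum.elim p p' x = c} ≃ {x // p x = c} ⊕ {x // p' x = c} := Equiv.subtypeSum
  refine ⟨Finite.of_equiv _ e.symm, ?_⟩
  rw [Nat.card_congr e, Nat.card_sum, Nat.cast_add, (h c).2, (h' c).2, Pi.add_apply]

theorem sigma {α : Type*} [Fintype α] {X : α → Type*} {p : ∀ a, X a → γ} {V : α → γ → ℤ}
    (h : ∀ a, Enumerates (p a) (V a)) :
    Enumerates (fun x : Σ a, X a => p x.1 x.2) (∑ a, V a) := fun c => by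
  have := fun a => (h a c).1
  let e := subtypeSigmaEquivSigmaSubtype fun a x => p a x = c
  refine ⟨Finite.of_equiv _ e.symm, ?_⟩
  rw [Nat.card_congr e, Nat.card_sigma, Nat.cast_sum, Finset.sum_apply]
  exact Finset.sum_congr rfl fun a _ => (h a c).2

theorem exists_equiv (h : Enumerates p V) (h' : Enumerates p' V) :
    ∃ e : ι ≃ ι', ∀ x, p' (e x) = p x := by
  have fibre : ∀ c, Nonempty ({x // p x = c} ≃ {x // p' x = c}) := fun c => by
    have := (h c).1
    have := (h' c).1
    exact Finite.card_eq.1 (by exact_mod_cast (h c).2.trans (h' c).2.symm)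
  exact ⟨Equiv.ofFiberEquiv fun c => (fibre c).some, Equiv.ofFiberEquiv_map _⟩

theorem card_subtype_mem (h : Enumerates p V) {S : Set γ}
    (hS : (S ∩ Function.support V).Finite) :
    (Nat.card {x // p x ∈ S} : ℤ) = ∑ᶠ c ∈ S, V c := by
  have fibre_ne_zero : ∀ x, V (p x) ≠ 0 := fun x => by
    have := (h (p x)).1
    have : Nonempty {y // p y = p x} := ⟨⟨x, rfl⟩⟩
    exact (h (p x)).2 ▸ Nat.cast_ne_zero.2 Nat.card_pos.ne'
  have := fun c => (h c).1
  have := hS.fintype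
  let e : (Σ c : ↥(S ∩ Function.support V), {x // p x = c}) ≃ {x // p x ∈ S} :=
    Equiv.sigmaSubtypeFiberEquivSubtype p fun x => (and_iff_left (fibre_ne_zero x)).symm
  calc (Nat.card {x // p x ∈ S} : ℤ)
      = ∑ c : ↥(S ∩ Function.support V), (Nat.card {x // p x = c} : ℤ) := by
        rw [← Nat.card_congr e, Nat.card_sigma, Nat.cast_sum]
    _ = ∑ c : ↥(S ∩ Function.support V), V c := Finset.sum_congr rfl fun c _ => (h c).2
    _ = ∑ᶠ c ∈ S, V c := by
        rw [← finsum_eq_sum_of_fintype, finsum_set_coe_eq_finsum_mem, finsum_mem_inter_support]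

end Enumerates

theorem enumerates_graph {α β : Type*} {g : α → β} {W : α × β → ℤ} [DecidableEq β]
    (hW : ∀ i j, W (i, j) = if j = g i then 1 else 0) :
    Enumerates (fun i => (i, g i)) W := fun ⟨i, j⟩ => by
  rw [hW]
  split_ifs with h
  · have : Unique {x // (x, g x) = (i, j)} :=
      ⟨⟨⟨i, by rw [h]⟩⟩, fun x => Subtype.ext (congrArg Prod.fst x.2)⟩
    exact ⟨inferInstance, by rw [Nat.card_unique, Nat.cast_one]⟩
  · have : IsEmpty {x // (x, g x) = (i, j)} := ⟨fun ⟨x, hx⟩ => by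
      cases hx
      exact h rfl⟩
    exact ⟨inferInstance, by rw [Nat.card_of_isEmpty, Nat.cast_zero]⟩

end Multiplicity

section LinearAlgebra

theorem finrank_supported (R : Type*) [Semiring R] [StrongRankCondition R] {ι : Type*}
    (s : Set ι) : Module.finrank R (Finsupp.supported R R s) = Nat.card s :=
  Module.finrank_eq_nat_card_basis
    (Finsupp.basisSingleOne.map (Finsupp.supportedEquivFinsupp s).symm)

theorem finrank_quotient_supported (R : Type*) [Ring R] [StrongRankCondition R] {ι : Type*}
    (s : Set ι) : Module.finrank R ((ι →₀ R) ⧸ Finsupp.supported R R s) = Nat.card ↥sᶜ := by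
  have : IsCompl (Finsupp.supported R R s) (Finsupp.supported R R sᶜ) :=
    ⟨Finsupp.disjoint_supported_supported isCompl_compl.disjoint,
      Finsupp.codisjoint_supported_supported isCompl_compl.codisjoint⟩
  rw [(Submodule.quotientEquivOfIsCompl _ _ this).finrank_eq, finrank_supported]

theorem basis_equiv_comm {R M M' N N' α β : Type*} [Semiring R] [AddCommMonoid M]
    [AddCommMonoid M'] [AddCommMonoid N] [AddCommMonoid N'] [Module R M] [Module R M'] [Module R N]
    [Module R N'] (b : Module.Basis α R M) (b' : Module.Basis α R M') (c : Module.Basis β R N)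
    (c' : Module.Basis β R N') {r : M →ₗ[R] N} {r' : M' →ₗ[R] N'} {φ : α → β}
    (hr : ∀ x, r (b x) = c (φ x)) (hr' : ∀ x, r' (b' x) = c' (φ x)) (y : M) :
    r' (b.equiv b' (Equiv.refl α) y) = c.equiv c' (Equiv.refl β) (r y) := by
  have h : r' ∘ₗ (b.equiv b' (Equiv.refl α)).toLinearMap =
      (c.equiv c' (Equiv.refl β)).toLinearMap ∘ₗ r :=
    b.ext fun x => by simp [hr, hr']
  exact LinearMap.congr_fun h y

theorem prodMap_basis_prod_apply {R M M' N N' α α' β β' : Type*} [Semiring R] [AddCommMonoid M]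
    [AddCommMonoid M'] [AddCommMonoid N] [AddCommMonoid N'] [Module R M] [Module R M'] [Module R N]
    [Module R N'] {b : Module.Basis α R M} {b' : Module.Basis α' R M'} {c : Module.Basis β R N}
    {c' : Module.Basis β' R N'} {r : M →ₗ[R] N} {r' : M' →ₗ[R] N'} {φ : α → β} {φ' : α' → β'}
    (hr : ∀ x, r (b x) = c (φ x)) (hr' : ∀ x, r' (b' x) = c' (φ' x)) (x : α ⊕ α') :
    r.prodMap r' (b.prod b' x) = c.prod c' (Sum.map φ φ' x) := by
  obtain x | x := x <;> simp [hr, hr']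

theorem dfinsupp_basis_apply {R ι : Type*} {M : ι → Type*} {α : ι → Type*} [Semiring R]
    [DecidableEq ι] [∀ i, AddCommMonoid (M i)] [∀ i, Module R (M i)]
    (b : ∀ i, Module.Basis (α i) R (M i)) (x : Σ i, α i) :
    DFinsupp.basis b x = DFinsupp.single x.1 (b x.1 x.2) := by
  rw [Module.Basis.apply_eq_iff]
  simp only [DFinsupp.basis, LinearEquiv.trans_apply, DFinsupp.mapRange.linearEquiv_apply,
    DFinsupp.mapRange_single, Module.Basis.repr_self]
  exact (Equiv.symm_apply_eq _).2 (sigmaFinsuppEquivDFinsupp_single x 1).symm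

theorem lmap_dfinsupp_basis_apply {R ι : Type*} {M N : ι → Type*} {α β : ι → Type*} [Semiring R]
    [∀ i, AddCommMonoid (M i)] [∀ i, AddCommMonoid (N i)] [∀ i, Module R (M i)]
    [∀ i, Module R (N i)] {b : ∀ i, Module.Basis (α i) R (M i)}
    {c : ∀ i, Module.Basis (β i) R (N i)} {r : ∀ i, M i →ₗ[R] N i} {φ : ∀ i, α i → β i}
    (hr : ∀ i x, r i (b i x) = c i (φ i x)) (x : Σ i, α i) :
    DirectSum.lmap r (DFinsupp.basis b x) = DFinsupp.basis c (Sigma.map id φ x) := by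
  classical
  rw [dfinsupp_basis_apply, dfinsupp_basis_apply]
  exact (DirectSum.lmap_lof r x.1 _).trans (congrArg (DirectSum.lof R ι N x.1) (hr x.1 x.2))

end LinearAlgebra

namespace KDiagram

variable {k : Type u} [Field k]

section OfSubmodules

/-- The diagram `P → A ← A → A ← Q` of inclusions of two submodules `P` and `Q` of `A`, in which
`B₃ = A₁ = A₂ = A` with identity maps. -/
abbrev ofSubmodules {A : Type u} [AddCommGroup A] [Module k A] (P Q : Submodule k A) :
    KDiagram k where
  B1 := P
  B2 := Q
  B3 := A
  A1 := A
  A2 := A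
  r11 := P.subtype
  r22 := Q.subtype
  r31 := LinearMap.id
  r32 := LinearMap.id

variable {A : Type u} [AddCommGroup A] [Module k A] (P Q : Submodule k A)

theorem mem_ker_differential_ofSubmodules {x : P × Q × A} :
    x ∈ LinearMap.ker (ofSubmodules P Q).differential ↔
      (x.1 : A) = x.2.2 ∧ (x.2.1 : A) = x.2.2 := by
  rw [LinearMap.mem_ker, differential_apply, Prod.mk_eq_zero, sub_eq_zero, sub_eq_zero]
  rfl

/-- `H⁰` of the diagram of `P` and `Q` is `P ⊓ Q`, as seen in `B₃`. -/
def H0OfSubmodulesEquiv : (ofSubmodules P Q).H0 ≃ₗ[k] ↥(P ⊓ Q) where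
  toFun x := ⟨x.1.2.2, by
    obtain ⟨hP, hQ⟩ := (mem_ker_differential_ofSubmodules P Q).1 x.2
    exact ⟨hP ▸ x.1.1.2, hQ ▸ x.1.2.1.2⟩⟩
  map_add' _ _ := rfl
  map_smul' _ _ := rfl
  invFun y := ⟨(⟨y, y.2.1⟩, ⟨y, y.2.2⟩, y.1),
    (mem_ker_differential_ofSubmodules P Q).2 ⟨rfl, rfl⟩⟩
  left_inv x := by
    obtain ⟨hP, hQ⟩ := (mem_ker_differential_ofSubmodules P Q).1 x.2
    exact Subtype.ext (Prod.ext (Subtype.ext hP.symm) (Prod.ext (Subtype.ext hQ.symm) rfl))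
  right_inv _ := rfl

theorem b0_ofSubmodules : (ofSubmodules P Q).b0 = Module.finrank k ↥(P ⊓ Q) :=
  (H0OfSubmodulesEquiv P Q).finrank_eq

theorem range_differential_ofSubmodules :
    LinearMap.range (ofSubmodules P Q).differential =
      LinearMap.ker ((P ⊔ Q).mkQ ∘ₗ (LinearMap.fst k A A - LinearMap.snd k A A)) := by
  ext ⟨a, b⟩
  rw [LinearMap.mem_ker, LinearMap.comp_apply, Submodule.mkQ_apply, Submodule.Quotient.mk_eq_zero,
    LinearMap.sub_apply, Submodule.mem_sup]
  constructor
  · rintro ⟨⟨x, y, c⟩, h⟩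
    obtain ⟨rfl, rfl⟩ := Prod.ext_iff.1 h
    refine ⟨x, x.2, -y, neg_mem y.2, ?_⟩
    change (x : A) + -y = (x - c) - (y - c)
    abel
  · rintro ⟨x, hx, y, hy, h : x + y = a - b⟩
    refine ⟨(⟨x, hx⟩, ⟨-y, neg_mem hy⟩, x - a), Prod.ext (sub_sub_cancel x a) ?_⟩
    calc -y - (x - a) = a - (x + y) := by abel
      _ = b := by rw [h, sub_sub_cancel]

theorem b1_ofSubmodules : (ofSubmodules P Q).b1 = Module.finrank k (A ⧸ (P ⊔ Q)) := by
  have surj : Function.Surjective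
      ((P ⊔ Q).mkQ ∘ₗ (LinearMap.fst k A A - LinearMap.snd k A A)) :=
    (Submodule.mkQ_surjective _).comp fun a => ⟨(a, 0), sub_zero a⟩
  exact ((Submodule.quotEquivOfEq _ _ (range_differential_ofSubmodules P Q)).trans
    (LinearMap.quotKerEquivOfSurjective _ surj)).finrank_eq

end OfSubmodules

section PointDiagram

open Set

/-- The direct sum over `x : ι` of the elementary diagrams attached to the points `p x`: each `x`
spans a line in `B₃`, `A₁` and `A₂`, one in `B₁` if the first coordinate of `p x` is at most that of
`d`, and one in `B₂` if this holds for the second coordinates. -/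
noncomputable def pointDiagram (k : Type u) [Field k] {ι : Type} (p : ι → ℤ × ℤ) (d : ℤ × ℤ) :
    KDiagram k :=
  ofSubmodules (Finsupp.supported k k {x | (p x).1 ≤ d.1})
    (Finsupp.supported k k {x | (p x).2 ≤ d.2})

variable {ι : Type} (p : ι → ℤ × ℤ) (d : ℤ × ℤ)

theorem b0_pointDiagram : (pointDiagram k p d).b0 = Nat.card {x // p x ∈ Iic d} := by
  rw [pointDiagram, b0_ofSubmodules, ← Finsupp.supported_inter, finrank_supported]
  rfl

theorem b1_pointDiagram : (pointDiagram k p d).b1 = Nat.card {x // p x ∈ openQuadrant d} := by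
  have compl : ({x | (p x).1 ≤ d.1} ∪ {x | (p x).2 ≤ d.2})ᶜ = {x | p x ∈ openQuadrant d} := by
    ext x
    simp only [mem_compl_iff, mem_union, mem_ofPred_eq, mem_openQuadrant, not_or, not_le]
  rw [pointDiagram, b1_ofSubmodules, ← Finsupp.supported_union, finrank_quotient_supported, compl]
  rfl

end PointDiagram

section AdaptedBasis

/-- Bases of the five spaces of `F` that split it into elementary diagrams, one for each `x : ι`,
attached to the point `p x`. The basis of `B₁` (of `B₂`) is indexed by those `x` for which the first
(second) coordinate of `p x` is at most that of `d`, and the restriction maps preserve indices. -/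
structure AdaptedBasis (F : KDiagram k) {ι : Type*} (p : ι → ℤ × ℤ) (d : ℤ × ℤ) where
  basisB1 : Module.Basis {x // (p x).1 ≤ d.1} k F.B1
  basisB2 : Module.Basis {x // (p x).2 ≤ d.2} k F.B2
  basisB3 : Module.Basis ι k F.B3
  basisA1 : Module.Basis ι k F.A1
  basisA2 : Module.Basis ι k F.A2
  r11_apply : ∀ x, F.r11 (basisB1 x) = basisA1 x
  r22_apply : ∀ x, F.r22 (basisB2 x) = basisA2 x
  r31_apply : ∀ x, F.r31 (basisB3 x) = basisA1 x
  r32_apply : ∀ x, F.r32 (basisB3 x) = basisA2 x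

namespace AdaptedBasis

variable {F G : KDiagram k} {ι ι' : Type*} {p : ι → ℤ × ℤ} {p' : ι' → ℤ × ℤ} {d : ℤ × ℤ}

/-- Diagrams with bases adapted to the same points are isomorphic. -/
noncomputable def iso (b : AdaptedBasis F p d) (b' : AdaptedBasis G p d) : Iso F G where
  eB1 := b.basisB1.equiv b'.basisB1 (Equiv.refl _)
  eB2 := b.basisB2.equiv b'.basisB2 (Equiv.refl _)
  eB3 := b.basisB3.equiv b'.basisB3 (Equiv.refl _)
  eA1 := b.basisA1.equiv b'.basisA1 (Equiv.refl _)
  eA2 := b.basisA2.equiv b'.basisA2 (Equiv.refl _)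
  comm11 := basis_equiv_comm _ _ _ _ b.r11_apply b'.r11_apply
  comm22 := basis_equiv_comm _ _ _ _ b.r22_apply b'.r22_apply
  comm31 := basis_equiv_comm _ _ _ _ b.r31_apply b'.r31_apply
  comm32 := basis_equiv_comm _ _ _ _ b.r32_apply b'.r32_apply

/-- Reindexing of an adapted basis along a bijection that preserves the attached points. -/
noncomputable def reindex (b : AdaptedBasis F p d) (e : ι ≃ ι') (he : ∀ x, p' (e x) = p x) :
    AdaptedBasis F p' d where
  basisB1 := b.basisB1.reindex (e.subtypeEquiv fun x => by rw [he])
  basisB2 := b.basisB2.reindex (e.subtypeEquiv fun x => by rw [he])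
  basisB3 := b.basisB3.reindex e
  basisA1 := b.basisA1.reindex e
  basisA2 := b.basisA2.reindex e
  r11_apply x := by simp [b.r11_apply]
  r22_apply x := by simp [b.r22_apply]
  r31_apply x := by simp [b.r31_apply]
  r32_apply x := by simp [b.r32_apply]

/-- The adapted basis of a direct sum of two diagrams. -/
noncomputable def sum (b : AdaptedBasis F p d) (b' : AdaptedBasis G p' d) :
    AdaptedBasis (F.sum G) (Sum.elim p p') d where
  basisB1 := (b.basisB1.prod b'.basisB1).reindex
    (Equiv.subtypeSum (p := fun x => (Sum.elim p p' x).1 ≤ d.1)).symm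
  basisB2 := (b.basisB2.prod b'.basisB2).reindex
    (Equiv.subtypeSum (p := fun x => (Sum.elim p p' x).2 ≤ d.2)).symm
  basisB3 := b.basisB3.prod b'.basisB3
  basisA1 := b.basisA1.prod b'.basisA1
  basisA2 := b.basisA2.prod b'.basisA2
  r11_apply
    | ⟨.inl x, hx⟩ => (congrArg _ (Module.Basis.reindex_apply _ _ _)).trans
        (prodMap_basis_prod_apply b.r11_apply b'.r11_apply (.inl ⟨x, hx⟩))
    | ⟨.inr x, hx⟩ => (congrArg _ (Module.Basis.reindex_apply _ _ _)).trans
        (prodMap_basis_prod_apply b.r11_apply b'.r11_apply (.inr ⟨x, hx⟩))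
  r22_apply
    | ⟨.inl x, hx⟩ => (congrArg _ (Module.Basis.reindex_apply _ _ _)).trans
        (prodMap_basis_prod_apply b.r22_apply b'.r22_apply (.inl ⟨x, hx⟩))
    | ⟨.inr x, hx⟩ => (congrArg _ (Module.Basis.reindex_apply _ _ _)).trans
        (prodMap_basis_prod_apply b.r22_apply b'.r22_apply (.inr ⟨x, hx⟩))
  r31_apply x := by
    obtain x | x := x <;> exact prodMap_basis_prod_apply b.r31_apply b'.r31_apply _
  r32_apply x := by
    obtain x | x := x <;> exact prodMap_basis_prod_apply b.r32_apply b'.r32_apply _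

/-- The adapted basis of the direct sum of a family of diagrams. -/
noncomputable def directSum {α : Type} {F : α → KDiagram k} {X : α → Type*}
    {p : ∀ a, X a → ℤ × ℤ} (b : ∀ a, AdaptedBasis (F a) (p a) d) :
    AdaptedBasis (KDiagram.directSum F) (fun x : Σ a, X a => p x.1 x.2) d where
  basisB1 := (DFinsupp.basis fun a => (b a).basisB1).reindex
    (subtypeSigmaEquivSigmaSubtype fun a x => (p a x).1 ≤ d.1).symm
  basisB2 := (DFinsupp.basis fun a => (b a).basisB2).reindex
    (subtypeSigmaEquivSigmaSubtype fun a x => (p a x).2 ≤ d.2).symm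
  basisB3 := DFinsupp.basis fun a => (b a).basisB3
  basisA1 := DFinsupp.basis fun a => (b a).basisA1
  basisA2 := DFinsupp.basis fun a => (b a).basisA2
  r11_apply _ := (congrArg _ (Module.Basis.reindex_apply _ _ _)).trans
    (lmap_dfinsupp_basis_apply (fun a => (b a).r11_apply) _)
  r22_apply _ := (congrArg _ (Module.Basis.reindex_apply _ _ _)).trans
    (lmap_dfinsupp_basis_apply (fun a => (b a).r22_apply) _)
  r31_apply := lmap_dfinsupp_basis_apply (φ := fun _ => id) fun a => (b a).r31_apply
  r32_apply := lmap_dfinsupp_basis_apply (φ := fun _ => id) fun a => (b a).r32_apply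

end AdaptedBasis

/-- The standard adapted basis of `pointDiagram k p d`. -/
noncomputable def pointDiagramAdaptedBasis {ι : Type} (p : ι → ℤ × ℤ) (d : ℤ × ℤ) :
    AdaptedBasis (pointDiagram k p d) p d where
  basisB1 := Finsupp.basisSingleOne.map (Finsupp.supportedEquivFinsupp _).symm
  basisB2 := Finsupp.basisSingleOne.map (Finsupp.supportedEquivFinsupp _).symm
  basisB3 := Finsupp.basisSingleOne
  basisA1 := Finsupp.basisSingleOne
  basisA2 := Finsupp.basisSingleOne
  r11_apply x := Finsupp.supportedEquivFinsupp_symm_single (R := k) (M := k) {x | (p x).1 ≤ d.1} x 1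
  r22_apply x := Finsupp.supportedEquivFinsupp_symm_single (R := k) (M := k) {x | (p x).2 ≤ d.2} x 1
  r31_apply _ := rfl
  r32_apply _ := rfl

theorem Multi.val_eq_of_graph {W : ℤ × ℤ → ℤ} {π : ℤ → ℤ}
    (hW : ∀ i j, W (i, j) = if j = π i then 1 else 0)
    (x : Multi fun c => ((W c).toNat : ℕ∞)) : x.1 = ((x.1.1.1, π x.1.1.1), 1) := by
  obtain ⟨⟨⟨i, j⟩, n⟩, one_le : 1 ≤ n, le_W⟩ := x
  have n_le : n ≤ (if j = π i then 1 else 0 : ℤ).toNat := hW i j ▸ Nat.cast_le.1 le_W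
  obtain ⟨rfl, rfl⟩ : j = π i ∧ n = 1 := by
    split_ifs at n_le with h
    · exact ⟨h, n_le.antisymm one_le⟩
    · exact absurd (one_le.trans n_le) (by decide)
  rfl

/-- The multiset of a matching is parametrised by the first coordinate. -/
def multiEquiv {W : ℤ × ℤ → ℤ} {π : ℤ → ℤ} (hW : ∀ i j, W (i, j) = if j = π i then 1 else 0) :
    Multi (fun c => ((W c).toNat : ℕ∞)) ≃ ℤ where
  toFun x := x.1.1.1
  invFun i := ⟨((i, π i), 1), le_rfl, by simp [hW]⟩
  left_inv x := Subtype.ext (x.val_eq_of_graph hW).symm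
  right_inv _ := rfl

/-- The adapted basis of the diagram of a matching, indexed by the first coordinate. -/
noncomputable def mIntAdaptedBasis {W : ℤ × ℤ → ℤ} {π : Equiv.Perm ℤ}
    (hW : ∀ i j, W (i, j) = if j = π i then 1 else 0) (d : ℤ × ℤ) :
    AdaptedBasis (MInt k W d) (fun i => (i, π i)) d where
  basisB1 := Finsupp.basisSingleOne
  basisB2 := Finsupp.basisSingleOne.reindex (π.subtypeEquiv fun _ => Iff.rfl).symm
  basisB3 := Finsupp.basisSingleOne.reindex (multiEquiv hW)
  basisA1 := Finsupp.basisSingleOne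
  basisA2 := Finsupp.basisSingleOne.reindex π.symm
  r11_apply _ := Finsupp.mapDomain_single
  r22_apply x := (congrArg _ (Module.Basis.reindex_apply _ _ _)).trans
    (Finsupp.mapDomain_single.trans (Finsupp.basisSingleOne.reindex_apply π.symm x).symm)
  r31_apply _ := (congrArg _ (Module.Basis.reindex_apply _ _ _)).trans Finsupp.mapDomain_single
  r32_apply x := (congrArg _ (Module.Basis.reindex_apply _ _ _)).trans
    (Finsupp.mapDomain_single.trans (Finsupp.basisSingleOne.reindex_apply π.symm x).symm)

end AdaptedBasis

section PointSum

/-- `F` is the direct sum of elementary diagrams, exactly `V c` of which are attached to each point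
`c`, as witnessed by an adapted basis. -/
def IsPointSum (F : KDiagram k) (V : ℤ × ℤ → ℤ) (d : ℤ × ℤ) : Prop :=
  ∃ (ι : Type) (p : ι → ℤ × ℤ), Enumerates p V ∧ Nonempty (AdaptedBasis F p d)

theorem isPointSum_MInt {W : ℤ × ℤ → ℤ} (hW : IsPerfectMatching W) (d : ℤ × ℤ) :
    IsPointSum (MInt k W d) W d :=
  let ⟨_, _, _, hπ⟩ := hW
  ⟨ℤ, _, enumerates_graph hπ, ⟨mIntAdaptedBasis hπ d⟩⟩

namespace IsPointSum

variable {F G : KDiagram k} {V V' : ℤ × ℤ → ℤ} {d : ℤ × ℤ}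

theorem sum (hF : IsPointSum F V d) (hG : IsPointSum G V' d) :
    IsPointSum (F.sum G) (V + V') d :=
  let ⟨_, _, hp, ⟨b⟩⟩ := hF
  let ⟨_, _, hp', ⟨b'⟩⟩ := hG
  ⟨_, _, hp.sum hp', ⟨b.sum b'⟩⟩

theorem directSum {α : Type} [Fintype α] {F : α → KDiagram k} {V : α → ℤ × ℤ → ℤ}
    (hF : ∀ a, IsPointSum (F a) (V a) d) :
    IsPointSum (KDiagram.directSum F) (∑ a, V a) d := by
  choose X p hp b using hF
  exact ⟨_, _, Enumerates.sigma hp, ⟨AdaptedBasis.directSum fun a => (b a).some⟩⟩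

theorem nonempty_iso (hF : IsPointSum F V d) (hG : IsPointSum G V d) : Nonempty (Iso F G) := by
  obtain ⟨_, _, hp, ⟨b⟩⟩ := hF
  obtain ⟨_, _, hp', ⟨b'⟩⟩ := hG
  obtain ⟨e, he⟩ := hp.exists_equiv hp'
  exact ⟨(b.reindex e he).iso b'⟩

theorem b0_eq_finsum_mem (hF : IsPointSum F V d) (hV : InitiallyZero V) :
    (F.b0 : ℤ) = ∑ᶠ c ∈ Set.Iic d, V c := by
  obtain ⟨_, p, hp, ⟨b⟩⟩ := hF
  rw [(b.iso (pointDiagramAdaptedBasis p d)).b0_eq, b0_pointDiagram,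
    hp.card_subtype_mem (hV.finite_Iic_inter_support d)]

theorem b1_eq_finsum_mem (hF : IsPointSum F V d) (hV : EventuallyZero V) :
    (F.b1 : ℤ) = ∑ᶠ c ∈ openQuadrant d, V c := by
  obtain ⟨_, p, hp, ⟨b⟩⟩ := hF
  rw [(b.iso (pointDiagramAdaptedBasis p d)).b1_eq, b1_pointDiagram,
    hp.card_subtype_mem (hV.finite_openQuadrant_inter_support d)]

end IsPointSum

end PointSum

end KDiagram

namespace MatchingDecomposition

open KDiagram

variable {W : ℤ × ℤ → ℤ} (D D' : MatchingDecomposition W) (k : Type u) [Field k] (d : ℤ × ℤ)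

theorem isPointSum_pos : IsPointSum (D.virtualDiagram k d).pos.1 (∑ i, D.pos i) d :=
  .directSum fun i => isPointSum_MInt (D.pos_matching i) d

theorem isPointSum_neg : IsPointSum (D.virtualDiagram k d).neg.1 (∑ i, D.neg i) d :=
  .directSum fun i => isPointSum_MInt (D.neg_matching i) d

theorem virtualClass_eq : D.virtualClass k d = D'.virtualClass k d := by
  have multiplicities : ∑ i, D'.pos i + ∑ i, D.neg i = ∑ i, D.pos i + ∑ i, D'.neg i :=
    (sub_eq_sub_iff_add_eq_add.1 (D.eq_sub.symm.trans D'.eq_sub)).symm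
  obtain ⟨e⟩ := ((D.isPointSum_pos k d).sum (D'.isPointSum_neg k d)).nonempty_iso
    (multiplicities ▸ (D'.isPointSum_pos k d).sum (D.isPointSum_neg k d))
  exact Quotient.sound ⟨(D.virtualDiagram k d).pos, ⟨e.sumCongr (Iso.refl _)⟩⟩

theorem finsum_mem_eq_sub {S : Set (ℤ × ℤ)}
    (hpos : (S ∩ Function.support (∑ i, D.pos i)).Finite)
    (hneg : (S ∩ Function.support (∑ i, D.neg i)).Finite) :
    ∑ᶠ c ∈ S, W c = ∑ᶠ c ∈ S, (∑ i, D.pos i) c - ∑ᶠ c ∈ S, (∑ i, D.neg i) c := by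
  rw [← Set.support_indicator] at hpos hneg
  simp only [finsum_mem_def]
  rw [← finsum_sub_distrib hpos hneg, ← Pi.sub_def, ← Set.indicator_sub', ← D.eq_sub]

theorem b0_virtualClass : (D.virtualClass k d).b0 = ∑ᶠ c ∈ Set.Iic d, W c := by
  have hpos : InitiallyZero (∑ i, D.pos i) := .sum fun i => (D.pos_matching i).1
  have hneg : InitiallyZero (∑ i, D.neg i) := .sum fun i => (D.neg_matching i).1
  rw [D.finsum_mem_eq_sub (hpos.finite_Iic_inter_support d) (hneg.finite_Iic_inter_support d),
    ← (D.isPointSum_pos k d).b0_eq_finsum_mem hpos, ← (D.isPointSum_neg k d).b0_eq_finsum_mem hneg]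
  rfl

theorem b1_virtualClass : (D.virtualClass k d).b1 = ∑ᶠ c ∈ openQuadrant d, W c := by
  have hpos : EventuallyZero (∑ i, D.pos i) := .sum fun i => (D.pos_matching i).2.1
  have hneg : EventuallyZero (∑ i, D.neg i) := .sum fun i => (D.neg_matching i).2.1
  rw [D.finsum_mem_eq_sub (hpos.finite_openQuadrant_inter_support d)
      (hneg.finite_openQuadrant_inter_support d),
    ← (D.isPointSum_pos k d).b1_eq_finsum_mem hpos, ← (D.isPointSum_neg k d).b1_eq_finsum_mem hneg]
  rfl

end MatchingDecomposition

theorem mainTheorem4 (k : Type u) [Field k] (f : ℤ × ℤ → ℤ) (C : ℤ)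
    (hf : IsRiemannFunction f C) (W : ℤ × ℤ → ℤ) (hW : IsWeight f W) (d : ℤ × ℤ) :
    (∀ D D' : MatchingDecomposition W, D.virtualClass k d = D'.virtualClass k d) ∧
    ∀ D : MatchingDecomposition W,
      f d = (D.virtualClass k d).b0 ∧
      (∀ K : ℤ × ℤ, dualFunction f C K (K - d) = (D.virtualClass k d).b1) ∧
      (D.virtualClass k d).eulerChar = deg d + C := by
  refine ⟨fun D D' => D.virtualClass_eq D' k d, fun D => ?_⟩
  have b0_eq : f d = (D.virtualClass k d).b0 := (hW.2 d).trans (D.b0_virtualClass k d).symm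
  have b1_eq : ∀ K, dualFunction f C K (K - d) = (D.virtualClass k d).b1 := fun K =>
    (hW.dualFunction_sub hf K d).trans (D.b1_virtualClass k d).symm
  refine ⟨b0_eq, b1_eq, ?_⟩
  rw [VirtualClass.eulerChar, ← b0_eq, ← b1_eq 0, dualFunction, sub_sub_cancel]
  ring
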